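/- Consider a perishable product with lifetime $K\ge 1$ periods and a planning horizon $t=1,\dots,T$. Demands $D_1,\dots,D_T\ge 0$ are random variables with finite means on a probability space, otherwise arbitrary (possibly nonstationary and correlated). At the beginning of period $t$ the information $F_t=(D_1,\dots,D_{t-1},U_1,\dots,U_t)$ is observed, where the $U_s$ are forecast signals. Let $X_{k,t}$ ($1\le k\le K-1$) be the inventory of age $k$ at the beginning of period $t$, with $X_{k,1}=0$. A policy $\pi$ chooses in period $t$ an ordering quantity $Q_t\ge 0$ as a (measurable) function of $\mathbf X_t=(X_{1,t},\dots,X_{K-1,t})$ and $F_t$; the order arrives at once. Put $X_{0,t}=Q_t$ and $Y_t=\sum_{k=0}^{K-1}X_{k,t}$. Demand is served oldest units first (FIFO), unmet demand is lost, and units reaching age $K$ are discarded: $$X_{k,t+1}=\Big(X_{k-1,t}-\Big(D_t-\sum_{m=k}^{K-1}X_{m,t}\Big)^+\Big)^+,\qquad k=1,\dots,K-1 .$$ Let $\beta\in(0,1]$ be the discount factor, and $\hat c\ge0,\ \hat p\ge\hat c,\ \hat h\ge 0,\ \hat w\ge-\beta\hat c$ the unit ordering, shortage, holding and outdating costs;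 units left at the end of the horizon have salvage value $\hat c$. Put $p=\hat p-\hat c$, $h=\hat h+(1-\beta)\hat c$, $w=\hat w+\beta\hat c$. The total cost of a policy $\pi$ is $$\hat{\mathscr C}(\pi)=\sum_{t=1}^T\beta^{t-1}\big(\hat cQ_t+\hat p(D_t-Y_t)^++\hat h(Y_t-D_t)^++\hat w(X_{K-1,t}-D_t)^+\big)-\beta^T\hat c\sum_{k=1}^{K-1}X_{k,T+1},$$ and its total cost in the transformed problem (with zero ordering cost) is $$\mathscr C(\pi)=\sum_{t=1}^T\beta^{t-1}\big(p(D_t-Y_t)^++h(Y_t-D_t)^++w(X_{K-1,t}-D_t)^+\big).$$ For an inventory vector $\mathbf x$, information $f$ and order $q$ in period $t$, write $y=q+\sum_{k=1}^{K-1}x_k$, $A_{0}=0$, $A_{k}=(A_{k-1}+D_{t+k-1}-x_{K-k})^+$, and define the expected marginal costs $$P_t=\beta^{t-1}p\,\mathrm E[(D_t-y)^+\mid F_t=f],$$ $$H_t=\sum_{0\le k\le \min(K-1,\,T-t)}\beta^{t+k-1}h\,\mathrm E\Big[\Big(q-\Big(A_{k}+D_{t+k}-\sum_{m=1}^{K-k-1}x_m\Big)^+\Big)^+\Big|\,F_t=f\Big],$$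 $$W_t=\beta^{t+K-2}w\,\mathrm E[(q-A_{K-1}-D_{t+K-1})^+\mid F_t=f]\ \text{ if } t\le T-K+1,\qquad W_t=0\ \text{ otherwise.}$$ A policy $B$ is a marginal-cost dual-balancing policy if in every period $t$, for all $\mathbf x\ge0$ and almost every $f$, its ordering quantity $q$ satisfies $P_t(\mathbf x,f,q)=H_t(\mathbf x,f,q)+W_t(\mathbf x,f,q)$. The base-stock policy with level $S\ge0$ orders $(S-\sum_{k=1}^{K-1}X_{k,t})^+$ in every period. Theorem. Let $B$ be any marginal-cost dual-balancing policy. Then the expected total cost of $B$ is finite and at most twice that of the base-stock policy $BA_S$ of any level $S\ge0$, whose expected total cost is finite as well; in particular it is at most twice that of an optimal base-stock policy $BA$: $$\mathrm E[\mathscr C(B)]\le 2\,\mathrm E[\mathscr C(BA_S)],\qquad \mathrm E[\hat{\mathscr C}(B)]\le 2\,\mathrm E[\hat{\mathscr C}(BA_S)]\qquad\text{for all }S\ge0 .$$ -/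

import Mathlib

open MeasureTheory ProbabilityTheory

namespace Perishable

/-- Information available at the beginning of period `t`: the realized demands
`d_1, …, d_{t-1}` and the forecast signals `u_1, …, u_t`. -/
abbrev Info (𝒰 : Type*) (t : ℕ) : Type _ :=
  (Set.Ico 1 t → ℝ) × (Set.Icc 1 t → 𝒰)

/-- Inventory vector `(x_1, …, x_{K-1})`; the entry with index `i : Fin (K-1)` is the amount of
age `i + 1`. -/
abbrev Inv (K : ℕ) : Type := Fin (K - 1) → ℝ

/-- Amount of age `k` after ordering `q` on top of the inventory vector `x`
(`x_0 = q`; ages above `K - 1` do not occur). -/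
def stock {K : ℕ} (x : Inv K) (q : ℝ) (k : ℕ) : ℝ :=
  if k = 0 then q else if h : k - 1 < K - 1 then x ⟨k - 1, h⟩ else 0

/-- Total inventory level after ordering, `y = ∑_{k=1}^{K-1} x_k + q`. -/
def total {K : ℕ} (x : Inv K) (q : ℝ) : ℝ := ∑ i, x i + q

/-- One period of the dynamics under FIFO issuing with lost sales: the inventory vector at the
beginning of the next period, `x'_k = (x_{k-1} - (d - ∑_{m=k}^{K-1} x_m)⁺)⁺`. -/
def nextInv {K : ℕ} (x : Inv K) (q d : ℝ) : Inv K := fun i =>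
  max (stock x q i - max (d - ∑ m ∈ Finset.Icc ((i : ℕ) + 1) (K - 1), stock x q m) 0) 0

/-- `A_{k,t}`: the demand over periods `t, …, t+k-1` of the demand path `d` that the inventory
`(x_{K-k}, …, x_{K-1})` held at the beginning of period `t` cannot satisfy. -/
def unmet {K : ℕ} (x : Inv K) (d : ℕ → ℝ) (t : ℕ) : ℕ → ℝ
  | 0 => 0
  | k + 1 => max (unmet x d t k + d (t + k) - stock x 0 (K - (k + 1))) 0

/-- Amount of the `q` units ordered at period `t` that is left in inventory at the end of period
`t + k`, along the demand path `d`. -/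
def leftOver {K : ℕ} (x : Inv K) (q : ℝ) (d : ℕ → ℝ) (t k : ℕ) : ℝ :=
  max (q - max (unmet x d t k + d (t + k)
    - ∑ m ∈ Finset.Icc 1 (K - k - 1), stock x 0 m) 0) 0

/-- Amount of the `q` units ordered at period `t` that outdates (at the end of period
`t + K - 1`), along the demand path `d`. -/
def outdated {K : ℕ} (x : Inv K) (q : ℝ) (d : ℕ → ℝ) (t : ℕ) : ℝ :=
  max (q - unmet x d t (K - 1) - d (t + K - 1)) 0

/-- The data of a periodic-review perishable inventory system. Periods are `1, …, T`; the values
of the processes `D` and `U` outside `1, …, T` play no role (they can be taken constant). -/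
structure Model {Ω : Type*} [MeasurableSpace Ω] (μ : Measure Ω)
    (𝒰 : Type*) [MeasurableSpace 𝒰] where
  /-- product lifetime -/
  K : ℕ
  one_le_K : 1 ≤ K
  /-- planning horizon -/
  T : ℕ
  /-- demand process -/
  D : ℕ → Ω → ℝ
  measurable_D : ∀ t, Measurable (D t)
  integrable_D : ∀ t, Integrable (D t) μ
  D_nonneg : ∀ t, ∀ᵐ ω ∂μ, 0 ≤ D t ω
  /-- forecast signals -/
  U : ℕ → Ω → 𝒰
  measurable_U : ∀ t, Measurable (U t)
  /-- discount factor -/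
  β : ℝ
  β_pos : 0 < β
  β_le_one : β ≤ 1
  /-- unit ordering cost (also the unit salvage value at the end of the horizon) -/
  cHat : ℝ
  /-- unit shortage penalty -/
  pHat : ℝ
  /-- unit holding cost -/
  hHat : ℝ
  /-- unit outdating cost, possibly negative -/
  wHat : ℝ
  cHat_nonneg : 0 ≤ cHat
  hHat_nonneg : 0 ≤ hHat
  cHat_le_pHat : 0 ≤ pHat - cHat
  wHat_ge : 0 ≤ wHat + β * cHat

/-- An ordering policy: at each period a (measurable) decision rule that maps the inventory vector
and the information to a nonnegative ordering quantity. -/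
structure Policy (K : ℕ) (𝒰 : Type*) [MeasurableSpace 𝒰] where
  order : (t : ℕ) → Inv K → Info 𝒰 t → ℝ
  measurable_order : ∀ t, Measurable (fun z : Inv K × Info 𝒰 t => order t z.1 z.2)
  order_nonneg : ∀ t x f, 0 ≤ order t x f

/-- The base-stock policy with level `S`: at every period, replenish the total inventory up to
`S`. -/
def baseStock (K : ℕ) (𝒰 : Type*) [MeasurableSpace 𝒰] (S : ℝ) : Policy K 𝒰 where
  order _ x _ := max (S - ∑ i, x i) 0
  measurable_order t := by fun_prop
  order_nonneg _ _ _ := le_max_right _ _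

namespace Model

variable {Ω : Type*} [MeasurableSpace Ω] {μ : Measure Ω} {𝒰 : Type*} [MeasurableSpace 𝒰]

/-- Unit shortage penalty of the transformed problem. -/
def p (M : Model μ 𝒰) : ℝ := M.pHat - M.cHat

/-- Unit holding cost of the transformed problem. -/
def h (M : Model μ 𝒰) : ℝ := M.hHat + (1 - M.β) * M.cHat

/-- Unit outdating cost of the transformed problem. -/
def w (M : Model μ 𝒰) : ℝ := M.wHat + M.β * M.cHat

/-- The random information `F_t = (D_1, …, D_{t-1}, U_1, …, U_t)`. -/
def info (M : Model μ 𝒰) (t : ℕ) (ω : Ω) : Info 𝒰 t :=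
  (fun s => M.D s ω, fun s => M.U s ω)

/-- The inventory vector `X_t` at the beginning of period `t ≥ 1` under the policy `π`, starting
from an empty system at `t = 1` (the value at `t = 0` is a dummy). -/
def inv (M : Model μ 𝒰) (π : Policy M.K 𝒰) : ℕ → Ω → Inv M.K
  | 0, _ => 0
  | 1, _ => 0
  | t + 2, ω => nextInv (M.inv π (t + 1) ω)
      (π.order (t + 1) (M.inv π (t + 1) ω) (M.info (t + 1) ω)) (M.D (t + 1) ω)

/-- The ordering quantity `Q_t` under the policy `π`. -/
def ordered (M : Model μ 𝒰) (π : Policy M.K 𝒰) (t : ℕ) (ω : Ω) : ℝ :=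
  π.order t (M.inv π t ω) (M.info t ω)

/-- The total inventory level `Y_t` after ordering under the policy `π`. -/
def level (M : Model μ 𝒰) (π : Policy M.K 𝒰) (t : ℕ) (ω : Ω) : ℝ :=
  total (M.inv π t ω) (M.ordered π t ω)

/-- The amount `X_{K-1,t}` of the oldest age after ordering under the policy `π`
(equal to `Q_t` if `K = 1`). -/
def oldest (M : Model μ 𝒰) (π : Policy M.K 𝒰) (t : ℕ) (ω : Ω) : ℝ :=
  stock (M.inv π t ω) (M.ordered π t ω) (M.K - 1)

/-- The total cost over the planning horizon under the policy `π`, in the original cost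
parameters. -/
noncomputable def costHat (M : Model μ 𝒰) (π : Policy M.K 𝒰) (ω : Ω) : ℝ :=
  ∑ t ∈ Finset.Icc 1 M.T, M.β ^ (t - 1) *
      (M.cHat * M.ordered π t ω
        + M.pHat * max (M.D t ω - M.level π t ω) 0
        + M.hHat * max (M.level π t ω - M.D t ω) 0
        + M.wHat * max (M.oldest π t ω - M.D t ω) 0)
    - M.β ^ M.T * M.cHat * ∑ i, M.inv π (M.T + 1) ω i

/-- The total cost over the planning horizon under the policy `π`, in the transformed problem
(zero ordering cost). -/
noncomputable def cost (M : Model μ 𝒰) (π : Policy M.K 𝒰) (ω : Ω) : ℝ :=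
  ∑ t ∈ Finset.Icc 1 M.T, M.β ^ (t - 1) *
      (M.p * max (M.D t ω - M.level π t ω) 0
        + M.h * max (M.level π t ω - M.D t ω) 0
        + M.w * max (M.oldest π t ω - M.D t ω) 0)

variable [IsFiniteMeasure μ]

/-- The conditional distribution of the demand path given the information at period `t`. -/
noncomputable def demandLaw (M : Model μ 𝒰) (t : ℕ) : Kernel (Info 𝒰 t) (ℕ → ℝ) :=
  condDistrib (fun ω s => M.D s ω) (M.info t) μ

/-- Expected marginal shortage penalty `P_t(x, f, q)`. -/
noncomputable def marginalShortage (M : Model μ 𝒰) (t : ℕ) (x : Inv M.K) (f : Info 𝒰 t)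
    (q : ℝ) : ℝ :=
  M.β ^ (t - 1) * M.p * ∫ d, max (d t - total x q) 0 ∂(M.demandLaw t f)

/-- Expected marginal holding cost `H_t(x, f, q)`: the expected discounted holding costs, until
the end of the horizon, of the units ordered at period `t`. -/
noncomputable def marginalHolding (M : Model μ 𝒰) (t : ℕ) (x : Inv M.K) (f : Info 𝒰 t)
    (q : ℝ) : ℝ :=
  ∑ k ∈ (Finset.range M.K).filter (fun k => t + k ≤ M.T),
    M.β ^ (t + k - 1) * M.h * ∫ d, leftOver x q d t k ∂(M.demandLaw t f)

/-- Expected marginal outdating cost `W_t(x, f, q)`: the expected discounted outdating cost of the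
units ordered at period `t`. It is charged in period `t + K - 1`, hence carries the factor
`β ^ (t + K - 2)`, and it vanishes if that period lies beyond the horizon. -/
noncomputable def marginalOutdating (M : Model μ 𝒰) (t : ℕ) (x : Inv M.K) (f : Info 𝒰 t)
    (q : ℝ) : ℝ :=
  if t + M.K ≤ M.T + 1 then
    M.β ^ (t + M.K - 2) * M.w * ∫ d, outdated x q d t ∂(M.demandLaw t f)
  else 0

/-- `B` is a marginal-cost dual-balancing policy: at each period, for (almost) every information
and every inventory vector, the ordering quantity equates the expected marginal shortage penalty
with the sum of the expected marginal holding and outdating costs. (Conditional distributions are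
only determined up to null sets of information.) -/
def IsDualBalancing (M : Model μ 𝒰) (B : Policy M.K 𝒰) : Prop :=
  ∀ t ∈ Finset.Icc 1 M.T, ∀ᵐ f ∂(μ.map (M.info t)), ∀ x : Inv M.K, (∀ i, 0 ≤ x i) →
    M.marginalShortage t x f (B.order t x f)
      = M.marginalHolding t x f (B.order t x f) + M.marginalOutdating t x f (B.order t x f)

end Model

end Perishable

/-! The proof charges every cost to the order that causes it. FIFO issuing makes the fate of the
units ordered in period `t` independent of later orders, so along each demand path the total cost is
the sum over `t` of a shortage penalty and an overage cost, namely the holding and outdating of the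
units ordered in `t` (`Model.pathCost_eq`). Dual balancing equates the conditional expectations of
the two given `F_t`; hence `E[C(B)]` is twice the expected total shortage penalty, and on any event
known at the start of `t` one of the two may be exchanged for the other (`IsDualBalancing.balance`).

Fix `S`. In each period, exchange shortage for overage on the event that the level of `B` is below
`S`. It then suffices to show pathwise that overage costs of orders placed below `S`, plus shortage
penalties in the other periods, do not exceed the cost of the base-stock policy, whose level is
always exactly `S` (`Model.le_pathCost`). Three comparisons give this.

Shortage: a level of at least `S` leaves no more demand unmet than the level `S`.

Holding: take the youngest order placed below `S` that is counted in period `s`. All units at least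
as old were on hand when it was placed, so there are at most `S` of them, and at most `(S - d_s)⁺`
are left after demand (`sum_endStock_le`).

Outdating is compared cumulatively (`sum_expired_le`). If units ordered in `t` outdate, all demand
in `t, …, t+K-1` was served from the stock held in `t`, so outdating in this window is exactly the
level minus the demand; the base-stock system outdates at least `S` minus the same demand. Discount
factors are nonincreasing, so summation by parts passes to discounted sums.

The original cost exceeds the transformed one by the nonnegative, policy-independent cost of
ordering exactly the demand, so the factor 2 carries over. -/

namespace Perishable

/-! ### Pathwise FIFO dynamics, expressed through the stock of age at least `j`. -/

section Pathwise

variable {K : ℕ}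

/-- Amount of age at least `j` after ordering. -/
def tail (x : Inv K) (q : ℝ) (j : ℕ) : ℝ := ∑ m ∈ Finset.Icc j (K - 1), stock x q m

theorem stock_nonneg {x : Inv K} {q : ℝ} (hx : ∀ i, 0 ≤ x i) (hq : 0 ≤ q) (k : ℕ) :
    0 ≤ stock x q k := by
  unfold stock
  split_ifs
  exacts [hq, hx _, le_rfl]

theorem stock_eq_of_ne_zero (x : Inv K) (q q' : ℝ) {k : ℕ} (hk : k ≠ 0) :
    stock x q k = stock x q' k := by
  simp [stock, hk]

theorem tail_nonneg {x : Inv K} {q : ℝ} (hx : ∀ i, 0 ≤ x i) (hq : 0 ≤ q) (j : ℕ) :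
    0 ≤ tail x q j :=
  Finset.sum_nonneg fun m _ => stock_nonneg hx hq m

theorem tail_eq_add (x : Inv K) (q : ℝ) {j : ℕ} (hj : j ≤ K - 1) :
    tail x q j = stock x q j + tail x q (j + 1) := by
  rw [tail, tail, ← Finset.insert_Icc_add_one_left_eq_Icc hj, Finset.sum_insert (by simp)]

theorem tail_of_lt (x : Inv K) (q : ℝ) {j : ℕ} (hj : K - 1 < j) : tail x q j = 0 := by
  rw [tail, Finset.Icc_eq_empty (by omega), Finset.sum_empty]

theorem tail_one (x : Inv K) (q : ℝ) : tail x q 1 = ∑ i, x i := by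
  rw [tail, ← Finset.Ico_add_one_right_eq_Icc, Finset.sum_Ico_eq_sum_range, Nat.add_sub_cancel,
    Finset.sum_range]
  refine Finset.sum_congr rfl fun i _ => ?_
  simp [stock, add_comm 1]

theorem tail_zero (x : Inv K) (q : ℝ) : tail x q 0 = total x q := by
  rw [tail_eq_add x q (Nat.zero_le _), tail_one, total, add_comm]
  simp [stock]

theorem tail_last (x : Inv K) (q : ℝ) : tail x q (K - 1) = stock x q (K - 1) := by
  rw [tail, Finset.Icc_self, Finset.sum_singleton]

theorem nextInv_nonneg (x : Inv K) (q d : ℝ) (i : Fin (K - 1)) : 0 ≤ nextInv x q d i :=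
  le_max_right _ _

theorem unmet_nonneg (x : Inv K) (d : ℕ → ℝ) (t k : ℕ) : 0 ≤ unmet x d t k := by
  cases k with
  | zero => exact le_rfl
  | succ k => exact le_max_right _ _

/-- FIFO bookkeeping: with `r` older units issued first, what is left of `a` is what is left of `a +
r` minus what is left of `r`. This makes age classes differences of tails, so that sums over ages
telescope. -/
theorem posPart_sub_sub {a r d : ℝ} (ha : 0 ≤ a) :
    max (a - max (d - r) 0) 0 = max (a + r - d) 0 - max (r - d) 0 := by
  rcases le_total d r with h | h
  · rw [max_eq_right (by linarith : d - r ≤ 0), max_eq_left (by linarith : 0 ≤ a + r - d),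
      max_eq_left (by linarith : 0 ≤ r - d), max_eq_left (by linarith)]
    ring
  · rw [max_eq_left (by linarith : 0 ≤ d - r), max_eq_right (by linarith : r - d ≤ 0), sub_zero]
    congr 1
    ring

theorem posPart_posPart_sub {z d : ℝ} (hd : 0 ≤ d) : max (max z 0 - d) 0 = max (z - d) 0 := by
  rcases le_total z 0 with h | h
  · rw [max_eq_right h, max_eq_right (by linarith), max_eq_right (by linarith)]
  · rw [max_eq_left h]

theorem stock_nextInv {x : Inv K} {q : ℝ} (hx : ∀ i, 0 ≤ x i) (hq : 0 ≤ q) (d q' : ℝ) {j : ℕ}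
    (hj : j + 1 ≤ K - 1) :
    stock (nextInv x q d) q' (j + 1)
      = max (tail x q j - d) 0 - max (tail x q (j + 1) - d) 0 := by
  have h : j < K - 1 := hj
  rw [tail_eq_add x q h.le, ← posPart_sub_sub (stock_nonneg hx hq j)]
  simp [stock, nextInv, h, tail]

/-- The classes telescope; the subtracted boundary term is the amount that outdates. -/
theorem tail_nextInv {x : Inv K} {q : ℝ} (hx : ∀ i, 0 ≤ x i) (hq : 0 ≤ q) (d q' : ℝ) {j : ℕ}
    (hj : j ≤ K - 1) :
    tail (nextInv x q d) q' (j + 1)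
      = max (tail x q j - d) 0 - max (tail x q (K - 1) - d) 0 := by
  induction hj using Nat.decreasingInduction with
  | self => rw [tail_of_lt _ _ (by omega), sub_self]
  | of_succ j hj ih =>
    rw [tail_eq_add _ _ hj, ih, stock_nextInv hx hq d q' hj]
    ring

theorem tail_nextInv_le {x : Inv K} {q d : ℝ} (hx : ∀ i, 0 ≤ x i) (hq : 0 ≤ q) (hd : 0 ≤ d)
    (q' : ℝ) {j : ℕ} (hj : j ≤ K - 1) : tail (nextInv x q d) q' (j + 1) ≤ tail x q j := by
  rw [tail_nextInv hx hq d q' hj]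
  have h1 : max (tail x q j - d) 0 ≤ tail x q j :=
    max_le (by linarith) (tail_nonneg hx hq j)
  have h2 : 0 ≤ max (tail x q (K - 1) - d) 0 := le_max_right _ _
  linarith

theorem tail_succ_le {x : Inv K} {q : ℝ} (hx : ∀ i, 0 ≤ x i) (hq : 0 ≤ q) (j : ℕ) :
    tail x q (j + 1) ≤ tail x q j := by
  rcases le_or_gt j (K - 1) with h | h
  · rw [tail_eq_add x q h]
    linarith [stock_nonneg hx hq j]
  · rw [tail_of_lt x q h, tail_of_lt x q (by omega)]

/-! ### Trajectories: fate of each order, and comparison with level `S`. -/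

/-- A path of the system started empty in period `1`: inventory vectors, orders and demands. -/
structure IsTrajectory (x : ℕ → Inv K) (q d : ℕ → ℝ) : Prop where
  start : x 1 = 0
  step : ∀ t, 1 ≤ t → x (t + 1) = nextInv (x t) (q t) (d t)
  order_nonneg : ∀ t, 0 ≤ q t
  demand_nonneg : ∀ t, 0 ≤ d t

/-- Amount of age `k` left at the end of period `s`. -/
def endStock (x : ℕ → Inv K) (q d : ℕ → ℝ) (s k : ℕ) : ℝ :=
  max (tail (x s) (q s) k - d s) 0 - max (tail (x s) (q s) (k + 1) - d s) 0

/-- Amount that outdates at the end of period `s`. -/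
def expired (x : ℕ → Inv K) (q d : ℕ → ℝ) (s : ℕ) : ℝ :=
  max (tail (x s) (q s) (K - 1) - d s) 0

theorem expired_nonneg (x : ℕ → Inv K) (q d : ℕ → ℝ) (s : ℕ) : 0 ≤ expired x q d s :=
  le_max_right _ _

namespace IsTrajectory

variable {x : ℕ → Inv K} {q d : ℕ → ℝ}

theorem nonneg (H : IsTrajectory x q d) : ∀ t, 1 ≤ t → ∀ i, 0 ≤ x t i := by
  intro t ht i
  induction t, ht using Nat.le_induction with
  | base => simp [H.start]
  | succ t ht _ => rw [H.step t ht]; exact nextInv_nonneg _ _ _ _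

theorem tail_nonneg (H : IsTrajectory x q d) {t : ℕ} (ht : 1 ≤ t) (j : ℕ) :
    0 ≤ tail (x t) (q t) j :=
  Perishable.tail_nonneg (H.nonneg t ht) (H.order_nonneg t) j

theorem tail_succ (H : IsTrajectory x q d) {t : ℕ} (ht : 1 ≤ t) {j : ℕ} (hj : j ≤ K - 1) :
    tail (x (t + 1)) (q (t + 1)) (j + 1)
      = max (tail (x t) (q t) j - d t) 0 - expired x q d t := by
  rw [H.step t ht, tail_nextInv (H.nonneg t ht) (H.order_nonneg t) _ _ hj, expired]

theorem tail_succ_le (H : IsTrajectory x q d) {t : ℕ} (ht : 1 ≤ t) {j : ℕ} (hj : j ≤ K - 1) :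
    tail (x (t + 1)) (q (t + 1)) (j + 1) ≤ tail (x t) (q t) j := by
  rw [H.step t ht]
  exact tail_nextInv_le (H.nonneg t ht) (H.order_nonneg t) (H.demand_nonneg t) _ hj

theorem tail_add_le (H : IsTrajectory x q d) {t : ℕ} (ht : 1 ≤ t) {k : ℕ} (hk : k ≤ K) :
    tail (x (t + k)) (q (t + k)) k ≤ tail (x t) (q t) 0 := by
  induction k with
  | zero => rfl
  | succ k ih =>
    exact (H.tail_succ_le (by omega : 1 ≤ t + k) (by omega)).trans (ih (by omega))

/-- The system starts empty, so no unit in period `s` can have been ordered before period `1`. -/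
theorem tail_eq_zero (H : IsTrajectory x q d) {s : ℕ} (hs : 1 ≤ s) {k : ℕ} (hk : s ≤ k) :
    tail (x s) (q s) k = 0 := by
  induction s, hs using Nat.le_induction generalizing k with
  | base =>
    refine Finset.sum_eq_zero fun m hm => ?_
    have : m ≠ 0 := by have := (Finset.mem_Icc.1 hm).1; omega
    simp [stock, this, H.start]
  | succ s hs ih =>
    obtain ⟨k, rfl⟩ : ∃ j, k = j + 1 := ⟨k - 1, by omega⟩
    rcases le_or_gt k (K - 1) with h | h
    · exact le_antisymm ((H.tail_succ_le hs h).trans_eq (ih (by omega)))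
        (H.tail_nonneg (by omega) _)
    · exact tail_of_lt _ _ (by omega)

theorem endStock_nonneg (H : IsTrajectory x q d) {s : ℕ} (hs : 1 ≤ s) (k : ℕ) :
    0 ≤ endStock x q d s k :=
  sub_nonneg.2 (max_le_max_right 0
    (sub_le_sub_right (Perishable.tail_succ_le (H.nonneg s hs) (H.order_nonneg s) k) _))

theorem endStock_eq_zero (H : IsTrajectory x q d) {s : ℕ} (hs : 1 ≤ s) {k : ℕ} (hk : s ≤ k) :
    endStock x q d s k = 0 := by
  rw [endStock, H.tail_eq_zero hs hk, H.tail_eq_zero hs (by omega), sub_self]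

theorem posPart_tail_of_lt (H : IsTrajectory x q d) (s : ℕ) {k : ℕ} (hk : K - 1 < k) :
    max (tail (x s) (q s) k - d s) 0 = 0 := by
  rw [tail_of_lt _ _ hk]
  exact max_eq_right (by linarith [H.demand_nonneg s])

theorem endStock_last (H : IsTrajectory x q d) (s : ℕ) :
    endStock x q d s (K - 1) = expired x q d s := by
  rw [endStock, H.posPart_tail_of_lt s (Nat.lt_succ_self _), sub_zero, expired]

theorem sum_endStock (H : IsTrajectory x q d) (hK : 1 ≤ K) (s : ℕ) :
    ∑ k ∈ Finset.range K, endStock x q d s k = max (total (x s) (q s) - d s) 0 := by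
  simp only [endStock]
  rw [Finset.sum_range_sub', H.posPart_tail_of_lt s (k := K) (by omega), sub_zero, tail_zero]

/-- The part of the inventory held after ordering in period `t` that is still there when period
`t + k` begins. -/
theorem tail_add (H : IsTrajectory x q d) {t : ℕ} (ht : 1 ≤ t) {k m : ℕ} (hk : k + m ≤ K)
    (hkK : k ≤ K - 1) :
    tail (x (t + k)) (q (t + k)) (k + m)
      = max (∑ j ∈ Finset.Icc m (K - k - 1), stock (x t) (q t) j - unmet (x t) d t k) 0 := by
  induction k generalizing m with
  | zero =>
    have := H.tail_nonneg ht m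
    simp only [tail] at this
    simp [unmet, tail, this]
  | succ k ih =>
    have hst : ∀ j, 0 ≤ stock (x t) (q t) j := stock_nonneg (H.nonneg t ht) (H.order_nonneg t)
    have h1 := ih (m := m) (by omega) (by omega)
    -- With this `m` the sum reduces to the oldest surviving class, which gives the amount expiring
    -- in period `t + k`.
    have h2 := ih (m := K - 1 - k) (by omega) (by omega)
    rw [show k + (K - 1 - k) = K - 1 by omega, show K - k - 1 = K - 1 - k by omega,
      Finset.Icc_self, Finset.sum_singleton] at h2
    have hlast : ∑ j ∈ Finset.Icc m (K - k - 1), stock (x t) (q t) j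
        = ∑ j ∈ Finset.Icc m (K - (k + 1) - 1), stock (x t) (q t) j
          + stock (x t) (q t) (K - 1 - k) := by
      rw [show K - k - 1 = (K - (k + 1) - 1) + 1 by omega,
        Finset.sum_Icc_succ_top (by omega)]
      congr 2
      omega
    rw [show t + (k + 1) = t + k + 1 by omega, show k + 1 + m = k + m + 1 by omega,
      H.tail_succ (by omega) (by omega), expired, h1, h2, hlast]
    have hs : stock (x t) 0 (K - (k + 1)) = stock (x t) (q t) (K - 1 - k) := by
      rw [show K - (k + 1) = K - 1 - k by omega]
      exact stock_eq_of_ne_zero _ _ _ (by omega)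
    simp only [unmet, hs]
    have hσ : 0 ≤ ∑ j ∈ Finset.Icc m (K - (k + 1) - 1), stock (x t) (q t) j :=
      Finset.sum_nonneg fun j _ => hst j
    have hd := H.demand_nonneg (t + k)
    generalize ∑ j ∈ Finset.Icc m (K - (k + 1) - 1), stock (x t) (q t) j = σ at hσ ⊢
    generalize stock (x t) (q t) (K - 1 - k) = a
    generalize unmet (x t) d t k = A
    generalize d (t + k) = D at hd ⊢
    rw [posPart_posPart_sub hd, posPart_posPart_sub hd, show A + D - a = (A + D) - a by ring, posPart_sub_sub hσ]
    congr 2 <;> ring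

/-- Links the marginal-cost formula, which sees only the state in period `t`, to the actual path:
`tail_add` with `m = 0` and `m = 1` includes and excludes the order of period `t`. -/
theorem leftOver_eq (H : IsTrajectory x q d) {t : ℕ} (ht : 1 ≤ t) {k : ℕ} (hk : k < K) :
    leftOver (x t) (q t) d t k = endStock x q d (t + k) k := by
  have h0 := H.tail_add ht (k := k) (m := 0) (by omega) (by omega)
  have h1 := H.tail_add ht (k := k) (m := 1) (by omega) (by omega)
  have hsplit : ∑ j ∈ Finset.Icc 0 (K - k - 1), stock (x t) (q t) j
      = q t + ∑ j ∈ Finset.Icc 1 (K - k - 1), stock (x t) (q t) j := by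
    rw [← Finset.insert_Icc_add_one_left_eq_Icc (Nat.zero_le _), Finset.sum_insert (by simp)]
    simp [stock]
  have hs : ∑ j ∈ Finset.Icc 1 (K - k - 1), stock (x t) 0 j
      = ∑ j ∈ Finset.Icc 1 (K - k - 1), stock (x t) (q t) j :=
    Finset.sum_congr rfl fun m hm =>
      stock_eq_of_ne_zero _ _ _ (by have := (Finset.mem_Icc.1 hm).1; omega)
  rw [add_zero, hsplit] at h0
  rw [leftOver, endStock, h0, h1, hs, posPart_sub_sub (H.order_nonneg t)]
  have hd := H.demand_nonneg (t + k)
  rw [posPart_posPart_sub hd, posPart_posPart_sub hd]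
  congr 2 <;> ring

theorem outdated_eq (H : IsTrajectory x q d) (hK : 1 ≤ K) {t : ℕ} (ht : 1 ≤ t) :
    outdated (x t) (q t) d t = expired x q d (t + (K - 1)) := by
  rw [← H.endStock_last, ← H.leftOver_eq ht (by omega), leftOver, outdated,
    Finset.Icc_eq_empty (by omega), Finset.sum_empty, sub_zero, Nat.add_sub_assoc hK,
    max_eq_left (a := unmet (x t) d t (K - 1) + _)
      (add_nonneg (unmet_nonneg _ _ _ _) (H.demand_nonneg _)), sub_sub]

/-- Among the units left at the end of a period, those ordered in periods with a total inventory
level below `S` are at most the units left when the total inventory level is `S`. -/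
theorem sum_endStock_le (H : IsTrajectory x q d) {S : ℝ} (c : ℕ → Prop) [DecidablePred c]
    (hc : ∀ t, 1 ≤ t → c t → total (x t) (q t) ≤ S) {s : ℕ} (hs : 1 ≤ s) {k : ℕ} (hk : k ≤ K) :
    ∑ j ∈ Finset.Ico k K, (if j < s ∧ c (s - j) then endStock x q d s j else 0)
      ≤ min (max (tail (x s) (q s) k - d s) 0) (max (S - d s) 0) := by
  -- Both bounds are needed: the tail bound absorbs the class of age `k`, while the bound by `S`
  -- survives when that class is not counted.
  induction hk using Nat.decreasingInduction with
  | self => simp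
  | of_succ k hk ih =>
    rw [Finset.sum_eq_sum_Ico_succ_bot hk]
    have hle := (le_min_iff.1 ih)
    have hend : max (tail (x s) (q s) k - d s) 0
        = endStock x q d s k + max (tail (x s) (q s) (k + 1) - d s) 0 := by
      rw [endStock]; ring
    have hnn := H.endStock_nonneg hs k
    split_ifs with h
    · have h1 : tail (x s) (q s) k ≤ S := by
        -- Every unit of age at least `k` in period `s` was already on hand in period `s - k`, when
        -- the level was at most `S`.
        have := H.tail_add_le (t := s - k) (by omega) hk.le
        rw [Nat.sub_add_cancel h.1.le, tail_zero] at this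
        exact this.trans (hc _ (by omega) h.2)
      have h2 : max (tail (x s) (q s) k - d s) 0 ≤ max (S - d s) 0 :=
        max_le_max_right 0 (by linarith)
      rw [min_eq_left h2]
      linarith [hle.1]
    · rw [zero_add]
      exact le_min (by linarith [hle.1]) hle.2

/-- Since part of the order of period `t` survives to outdate, FIFO serves the whole demand of the
window from the stock held in `t`; that stock leaves only through demand and outdating. -/
theorem sum_expired_eq_of_pos (H : IsTrajectory x q d) {t : ℕ} (ht : 1 ≤ t) (hK : 1 ≤ K)
    (hpos : 0 < expired x q d (t + (K - 1))) :
    ∑ k ∈ Finset.range K, expired x q d (t + k)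
      = total (x t) (q t) - ∑ k ∈ Finset.range K, d (t + k) := by
  -- Backwards in `k`: had demand exhausted this stock in period `t + k`, none of it could be left
  -- in the next period.
  have hlt : ∀ k, k ≤ K - 1 → d (t + k) < tail (x (t + k)) (q (t + k)) k := by
    intro k hk
    induction hk using Nat.decreasingInduction with
    | self =>
      by_contra hcon
      rw [expired, max_eq_right (by linarith)] at hpos
      exact lt_irrefl _ hpos
    | of_succ k hk ih =>
      have h1 := H.tail_succ (t := t + k) (by omega) (j := k) (by omega)
      have h2 := H.demand_nonneg (t + (k + 1))
      have h3 := expired_nonneg x q d (t + k)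
      rw [← add_assoc] at ih h2
      by_contra hcon
      rw [max_eq_right (by linarith)] at h1
      linarith
  have hsum : ∑ k ∈ Finset.range K, expired x q d (t + k)
      = ∑ k ∈ Finset.range K, ((tail (x (t + k)) (q (t + k)) k
          - tail (x (t + (k + 1))) (q (t + (k + 1))) (k + 1)) - d (t + k)) := by
    refine Finset.sum_congr rfl fun k hk => ?_
    have hk' : k ≤ K - 1 := by have := Finset.mem_range.1 hk; omega
    have h1 := H.tail_succ (t := t + k) (by omega) hk'
    have h2 := hlt k hk'
    rw [max_eq_left (by linarith)] at h1
    rw [← add_assoc]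
    linarith
  rw [hsum, Finset.sum_sub_distrib,
    Finset.sum_range_sub' (fun k => tail (x (t + k)) (q (t + k)) k),
    tail_of_lt _ _ (by omega : K - 1 < K), sub_zero, add_zero, tail_zero]

/-- In each period the stock held in `t` shrinks by at most demand plus outdating, and after `K`
periods it is gone. -/
theorem le_sum_expired (H : IsTrajectory x q d) {t : ℕ} (ht : 1 ≤ t) (hK : 1 ≤ K) :
    total (x t) (q t) - ∑ k ∈ Finset.range K, d (t + k)
      ≤ ∑ k ∈ Finset.range K, expired x q d (t + k) := by
  have hsum : ∑ k ∈ Finset.range K, ((tail (x (t + k)) (q (t + k)) k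
          - tail (x (t + (k + 1))) (q (t + (k + 1))) (k + 1)) - d (t + k))
      ≤ ∑ k ∈ Finset.range K, expired x q d (t + k) := by
    refine Finset.sum_le_sum fun k hk => ?_
    have hk' : k ≤ K - 1 := by have := Finset.mem_range.1 hk; omega
    have h1 := H.tail_succ (t := t + k) (by omega) hk'
    have h2 := le_max_left (tail (x (t + k)) (q (t + k)) k - d (t + k)) 0
    rw [← add_assoc]
    linarith
  rwa [Finset.sum_sub_distrib, Finset.sum_range_sub' (fun k => tail (x (t + k)) (q (t + k)) k),
    tail_of_lt _ _ (by omega : K - 1 < K), sub_zero, add_zero, tail_zero] at hsum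

/-- The cumulative amount of outdating units that were ordered in periods with a total inventory
level at most `S` does not exceed the cumulative outdating of a system whose total inventory level
is at least `S` in every period. -/
theorem sum_expired_le {x' : ℕ → Inv K} {q' : ℕ → ℝ} (H : IsTrajectory x q d)
    (H' : IsTrajectory x' q' d) (hK : 1 ≤ K) {S : ℝ} (c : ℕ → Prop) [DecidablePred c]
    (hc : ∀ t, 1 ≤ t → c t → total (x t) (q t) ≤ S)
    (hS : ∀ t, 1 ≤ t → S ≤ total (x' t) (q' t)) (n : ℕ) :
    ∑ s ∈ Finset.Ico 1 (n + 1), (if K ≤ s ∧ c (s - (K - 1)) then expired x q d s else 0)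
      ≤ ∑ s ∈ Finset.Ico 1 (n + 1), expired x' q' d s := by
  induction n using Nat.strong_induction_on with
  | _ n ih =>
  rcases Nat.eq_zero_or_pos n with rfl | hn
  · simp
  -- If the last term counts, the whole window `t, …, n` is compared at once and induction covers
  -- the periods before `t`; otherwise the last term is zero and drops out.
  by_cases hcase : (K ≤ n ∧ c (n - (K - 1))) ∧ 0 < expired x q d n
  · obtain ⟨⟨hKn, hcn⟩, hpos⟩ := hcase
    set t := n - (K - 1) with ht
    have ht1 : 1 ≤ t := by omega
    have htn : t + (K - 1) = n := by omega
    have hwin : ∀ f : ℕ → ℝ, ∑ s ∈ Finset.Ico t (n + 1), f s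
        = ∑ k ∈ Finset.range K, f (t + k) := by
      intro f
      rw [Finset.sum_Ico_eq_sum_range]
      congr 2
      omega
    rw [← Finset.sum_Ico_consecutive _ ht1 (by omega : t ≤ n + 1),
      ← Finset.sum_Ico_consecutive (fun s => expired x' q' d s) ht1 (by omega : t ≤ n + 1)]
    have h1 := ih (t - 1) (by omega)
    rw [Nat.sub_add_cancel ht1] at h1
    refine add_le_add h1 ?_
    calc _ ≤ ∑ s ∈ Finset.Ico t (n + 1), expired x q d s := by
          refine Finset.sum_le_sum fun s _ => ?_
          split_ifs
          exacts [le_rfl, expired_nonneg _ _ _ _]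
      _ = total (x t) (q t) - ∑ k ∈ Finset.range K, d (t + k) := by
          rw [hwin, H.sum_expired_eq_of_pos ht1 hK (by rwa [htn])]
      _ ≤ total (x' t) (q' t) - ∑ k ∈ Finset.range K, d (t + k) := by
          linarith [hc t ht1 hcn, hS t ht1]
      _ ≤ _ := by
          rw [hwin]
          exact H'.le_sum_expired ht1 hK
  · have hz : (if K ≤ n ∧ c (n - (K - 1)) then expired x q d n else 0) = 0 := by
      split_ifs with h
      · by_contra hne
        exact hcase ⟨h, lt_of_le_of_ne (expired_nonneg _ _ _ _) (Ne.symm hne)⟩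
      · rfl
    rw [Finset.sum_Ico_succ_top hn, Finset.sum_Ico_succ_top hn, hz]
    have h1 := ih (n - 1) (by omega)
    rw [Nat.sub_add_cancel hn] at h1
    linarith [expired_nonneg x' q' d n]

end IsTrajectory

/-! ### Summation by parts, and exchange of ordering and charging periods. -/

theorem sum_mul_le_sum_mul_of_antitone {c a b : ℕ → ℝ} (hc : Antitone c) (hc0 : ∀ n, 0 ≤ c n)
    (n : ℕ) (hab : ∀ m ≤ n, ∑ s ∈ Finset.range m, a s ≤ ∑ s ∈ Finset.range m, b s) :
    ∑ s ∈ Finset.range n, c s * a s ≤ ∑ s ∈ Finset.range n, c s * b s := by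
  -- Abel summation in inductive form: partial sums of `b - a` are nonnegative, so lowering the
  -- weight in front only decreases the left side.
  have key : ∀ m ≤ n, c m * ∑ s ∈ Finset.range m, (b s - a s)
      ≤ ∑ s ∈ Finset.range m, c s * (b s - a s) := by
    intro m
    induction m with
    | zero => simp
    | succ m ih =>
      intro hm
      have h1 := ih (by omega)
      have h2 := hab (m + 1) hm
      have h3 : 0 ≤ ∑ s ∈ Finset.range (m + 1), (b s - a s) := by
        rw [Finset.sum_sub_distrib]; linarith
      calc _ ≤ c m * ∑ s ∈ Finset.range (m + 1), (b s - a s) :=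
            mul_le_mul_of_nonneg_right (hc (Nat.le_succ m)) h3
        _ ≤ _ := by
          rw [Finset.sum_range_succ, Finset.sum_range_succ, mul_add]
          linarith
  have h1 := key n le_rfl
  have h2 : 0 ≤ ∑ s ∈ Finset.range n, (b s - a s) := by
    rw [Finset.sum_sub_distrib]; linarith [hab n le_rfl]
  have h3 := mul_nonneg (hc0 n) h2
  simp only [mul_sub, Finset.sum_sub_distrib] at h1 h3
  linarith

/-- Exchanging ordering periods `t` and charging periods `s = t + k`. -/
theorem sum_sum_reindex (K T : ℕ) (F : ℕ → ℕ → ℕ → ℝ) :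
    ∑ t ∈ Finset.Icc 1 T, ∑ k ∈ (Finset.range K).filter (fun k => t + k ≤ T), F t k (t + k)
      = ∑ s ∈ Finset.Icc 1 T, ∑ k ∈ Finset.range K,
          (if k < s then F (s - k) k s else 0) := by
  simp only [← Finset.sum_filter]
  rw [Finset.sum_sigma', Finset.sum_sigma']
  refine Finset.sum_bij' (fun a _ => ⟨a.1 + a.2, a.2⟩) (fun a _ => ⟨a.1 - a.2, a.2⟩) ?_ ?_ ?_ ?_ ?_
  all_goals
    rintro ⟨s, k⟩ h
    simp only [Finset.mem_sigma, Finset.mem_Icc, Finset.mem_filter, Finset.mem_range] at h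
  · simp only [Finset.mem_sigma, Finset.mem_Icc, Finset.mem_filter, Finset.mem_range]; omega
  · simp only [Finset.mem_sigma, Finset.mem_Icc, Finset.mem_filter, Finset.mem_range]; omega
  · simp
  · have : s - k + k = s := by omega
    simp [this]
  · simp

theorem sum_shift_reindex {K : ℕ} (hK : 1 ≤ K) (T : ℕ) (F : ℕ → ℕ → ℝ) :
    ∑ t ∈ Finset.Icc 1 T, (if t + K ≤ T + 1 then F t (t + (K - 1)) else 0)
      = ∑ s ∈ Finset.Icc 1 T, (if K ≤ s then F (s - (K - 1)) s else 0) := by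
  rw [← Finset.sum_filter, ← Finset.sum_filter]
  refine Finset.sum_bij' (fun t _ => t + (K - 1)) (fun s _ => s - (K - 1)) ?_ ?_ ?_ ?_ ?_
  all_goals
    intro s h
    simp only [Finset.mem_Icc, Finset.mem_filter] at h
  · simp only [Finset.mem_Icc, Finset.mem_filter]; omega
  · simp only [Finset.mem_Icc, Finset.mem_filter]; omega
  · omega
  · omega
  · rw [Nat.add_sub_cancel]

end Pathwise

end Perishable

namespace Perishable

namespace Model

/-! ### Marginal cost accounting and the pathwise cost comparison. -/

section Costs

variable {Ω : Type*} [MeasurableSpace Ω] {μ : Measure Ω} {𝒰 : Type*} [MeasurableSpace 𝒰]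

theorem p_nonneg (M : Model μ 𝒰) : 0 ≤ M.p := M.cHat_le_pHat

theorem h_nonneg (M : Model μ 𝒰) : 0 ≤ M.h :=
  add_nonneg M.hHat_nonneg (mul_nonneg (sub_nonneg.2 M.β_le_one) M.cHat_nonneg)

theorem w_nonneg (M : Model μ 𝒰) : 0 ≤ M.w := M.wHat_ge

theorem β_pow_nonneg (M : Model μ 𝒰) (n : ℕ) : 0 ≤ M.β ^ n := pow_nonneg M.β_pos.le n

/-- Shortage penalty in period `t` along a demand path. -/
noncomputable def shortageCost (M : Model μ 𝒰) (t : ℕ) (x : Inv M.K) (q : ℝ) (d : ℕ → ℝ) : ℝ :=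
  M.β ^ (t - 1) * M.p * max (d t - total x q) 0

/-- Holding and outdating costs of the units ordered in period `t` along a demand path. -/
noncomputable def overageCost (M : Model μ 𝒰) (t : ℕ) (x : Inv M.K) (q : ℝ) (d : ℕ → ℝ) : ℝ :=
  ∑ k ∈ (Finset.range M.K).filter (fun k => t + k ≤ M.T),
      M.β ^ (t + k - 1) * M.h * leftOver x q d t k
    + if t + M.K ≤ M.T + 1 then M.β ^ (t + M.K - 2) * M.w * outdated x q d t else 0

theorem shortageCost_nonneg (M : Model μ 𝒰) (t : ℕ) (x : Inv M.K) (q : ℝ) (d : ℕ → ℝ) :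
    0 ≤ M.shortageCost t x q d :=
  mul_nonneg (mul_nonneg (M.β_pow_nonneg _) M.p_nonneg) (le_max_right _ _)

theorem overageCost_nonneg (M : Model μ 𝒰) (t : ℕ) (x : Inv M.K) (q : ℝ) (d : ℕ → ℝ) :
    0 ≤ M.overageCost t x q d := by
  refine add_nonneg (Finset.sum_nonneg fun k _ => ?_) ?_
  · exact mul_nonneg (mul_nonneg (M.β_pow_nonneg _) M.h_nonneg) (le_max_right _ _)
  · split_ifs
    · exact mul_nonneg (mul_nonneg (M.β_pow_nonneg _) M.w_nonneg) (le_max_right _ _)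
    · exact le_rfl

/-- Total cost of the transformed problem along a path. -/
noncomputable def pathCost (M : Model μ 𝒰) (x : ℕ → Inv M.K) (q d : ℕ → ℝ) : ℝ :=
  ∑ t ∈ Finset.Icc 1 M.T, M.β ^ (t - 1) *
    (M.p * max (d t - total (x t) (q t)) 0 + M.h * max (total (x t) (q t) - d t) 0
      + M.w * max (stock (x t) (q t) (M.K - 1) - d t) 0)

/-- Overage costs of the units ordered in the periods satisfying `c`, charged when they occur. -/
theorem sum_overageCost (M : Model μ 𝒰) {x : ℕ → Inv M.K} {q d : ℕ → ℝ}
    (H : IsTrajectory x q d) (c : ℕ → Prop) [DecidablePred c] :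
    ∑ t ∈ Finset.Icc 1 M.T, (if c t then M.overageCost t (x t) (q t) d else 0)
      = ∑ s ∈ Finset.Icc 1 M.T, M.β ^ (s - 1) *
          (M.h * ∑ k ∈ Finset.range M.K,
              (if k < s ∧ c (s - k) then endStock x q d s k else 0)
            + M.w * (if M.K ≤ s ∧ c (s - (M.K - 1)) then expired x q d s else 0)) := by
  have hK := M.one_le_K
  have h1 : ∀ t ∈ Finset.Icc 1 M.T, (if c t then M.overageCost t (x t) (q t) d else 0)
      = ∑ k ∈ (Finset.range M.K).filter (fun k => t + k ≤ M.T),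
          (if c t then M.β ^ (t + k - 1) * M.h * endStock x q d (t + k) k else 0)
        + (if t + M.K ≤ M.T + 1 then
            (if c t then M.β ^ (t + (M.K - 1) - 1) * M.w * expired x q d (t + (M.K - 1)) else 0)
            else 0) := by
    intro t ht
    have ht1 := (Finset.mem_Icc.1 ht).1
    by_cases hct : c t
    · simp only [hct, if_true, overageCost]
      rw [H.outdated_eq hK ht1, show t + M.K - 2 = t + (M.K - 1) - 1 by omega]
      congr 1
      refine Finset.sum_congr rfl fun k hk => ?_
      rw [H.leftOver_eq ht1 (Finset.mem_range.1 (Finset.mem_filter.1 hk).1)]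
    · simp [hct]
  rw [Finset.sum_congr rfl h1, Finset.sum_add_distrib,
    sum_sum_reindex M.K M.T
      (fun t k s => if c t then M.β ^ (s - 1) * M.h * endStock x q d s k else 0),
    sum_shift_reindex hK M.T
      (fun t s => if c t then M.β ^ (s - 1) * M.w * expired x q d s else 0),
    ← Finset.sum_add_distrib]
  refine Finset.sum_congr rfl fun s _ => ?_
  rw [mul_add, Finset.mul_sum, Finset.mul_sum]
  congr 1
  · refine Finset.sum_congr rfl fun k _ => ?_
    by_cases ha : k < s <;> by_cases hb : c (s - k) <;> simp [ha, hb, mul_assoc]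
  · by_cases ha : M.K ≤ s <;> by_cases hb : c (s - (M.K - 1)) <;> simp [ha, hb, mul_assoc]

/-- Marginal cost accounting: the total cost is the sum of the costs caused by the orders. -/
theorem pathCost_eq (M : Model μ 𝒰) {x : ℕ → Inv M.K} {q d : ℕ → ℝ} (H : IsTrajectory x q d) :
    M.pathCost x q d = ∑ t ∈ Finset.Icc 1 M.T, M.shortageCost t (x t) (q t) d
      + ∑ t ∈ Finset.Icc 1 M.T, M.overageCost t (x t) (q t) d := by
  have h := M.sum_overageCost H (fun _ => True)
  simp only [if_true, and_true] at h
  rw [h, ← Finset.sum_add_distrib, pathCost]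
  refine Finset.sum_congr rfl fun s hs => ?_
  have hs1 := (Finset.mem_Icc.1 hs).1
  have h1 : ∑ k ∈ Finset.range M.K, (if k < s then endStock x q d s k else 0)
      = max (total (x s) (q s) - d s) 0 := by
    rw [← H.sum_endStock M.one_le_K]
    refine Finset.sum_congr rfl fun k _ => ?_
    split_ifs with hk
    · rfl
    · exact (H.endStock_eq_zero hs1 (by omega)).symm
  have h2 : (if M.K ≤ s then expired x q d s else 0)
      = max (stock (x s) (q s) (M.K - 1) - d s) 0 := by
    rw [← tail_last, ← expired]
    split_ifs with hk
    · rfl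
    · rw [← H.endStock_last, H.endStock_eq_zero hs1 (by omega)]
  rw [h1, h2, shortageCost]
  ring

/-- A system whose total inventory level is always `S` costs at least the shortage penalties of
another system in the periods where the latter has a level of at least `S`, plus the overage costs
of the units that the latter orders in the other periods. -/
theorem le_pathCost (M : Model μ 𝒰) {x x' : ℕ → Inv M.K} {q q' d : ℕ → ℝ}
    (H : IsTrajectory x q d) (H' : IsTrajectory x' q' d) {S : ℝ}
    (hS : ∀ t, 1 ≤ t → total (x' t) (q' t) = S) :
    ∑ t ∈ Finset.Icc 1 M.T, ((if total (x t) (q t) < S then M.overageCost t (x t) (q t) d else 0)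
        + (M.shortageCost t (x t) (q t) d
          - if total (x t) (q t) < S then M.shortageCost t (x t) (q t) d else 0))
      ≤ M.pathCost x' q' d := by
  have hK := M.one_le_K
  set c : ℕ → Prop := fun t => total (x t) (q t) < S with hcdef
  have hc : ∀ t, 1 ≤ t → c t → total (x t) (q t) ≤ S := fun t _ h => h.le
  have hexp : ∑ s ∈ Finset.Icc 1 M.T, M.β ^ (s - 1) *
        (if M.K ≤ s ∧ c (s - (M.K - 1)) then expired x q d s else 0)
      ≤ ∑ s ∈ Finset.Icc 1 M.T, M.β ^ (s - 1) * expired x' q' d s := by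
    have hr : ∀ (n : ℕ) (f : ℕ → ℝ), ∑ s ∈ Finset.Ico 1 (n + 1), f s
        = ∑ s ∈ Finset.range n, f (1 + s) := by
      intro n f
      rw [Finset.sum_Ico_eq_sum_range, Nat.add_sub_cancel]
    rw [← Finset.Ico_add_one_right_eq_Icc, hr, hr]
    simp only [Nat.add_sub_cancel_left]
    refine sum_mul_le_sum_mul_of_antitone
      (pow_right_anti₀ M.β_pos.le M.β_le_one) M.β_pow_nonneg _ fun m _ => ?_
    have := H.sum_expired_le H' hK c hc (fun t ht => (hS t ht).ge) m
    rwa [hr, hr] at this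
  rw [Finset.sum_add_distrib, M.sum_overageCost H c, pathCost]
  have hw := mul_le_mul_of_nonneg_left hexp M.w_nonneg
  rw [Finset.mul_sum, Finset.mul_sum] at hw
  have hrest : ∑ s ∈ Finset.Icc 1 M.T, (M.β ^ (s - 1) * (M.h * ∑ k ∈ Finset.range M.K,
          (if k < s ∧ c (s - k) then endStock x q d s k else 0))
        + (M.shortageCost s (x s) (q s) d
          - if c s then M.shortageCost s (x s) (q s) d else 0))
      ≤ ∑ s ∈ Finset.Icc 1 M.T, M.β ^ (s - 1) * (M.p * max (d s - total (x' s) (q' s)) 0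
          + M.h * max (total (x' s) (q' s) - d s) 0) := by
    refine Finset.sum_le_sum fun s hs => ?_
    have hs1 := (Finset.mem_Icc.1 hs).1
    have h1 := (le_min_iff.1 (H.sum_endStock_le c hc hs1 (Nat.zero_le M.K))).2
    rw [← Finset.range_eq_Ico] at h1
    have h2 : (M.shortageCost s (x s) (q s) d
          - if c s then M.shortageCost s (x s) (q s) d else 0)
        ≤ M.β ^ (s - 1) * (M.p * max (d s - S) 0) := by
      rw [← mul_assoc]
      have hbp := mul_nonneg (M.β_pow_nonneg (s - 1)) M.p_nonneg
      split_ifs with h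
      · rw [sub_self]
        exact mul_nonneg hbp (le_max_right _ _)
      · rw [sub_zero]
        refine mul_le_mul_of_nonneg_left (max_le_max_right 0 ?_) hbp
        linarith [not_lt.1 h]
    have h3 := mul_le_mul_of_nonneg_left (mul_le_mul_of_nonneg_left h1 M.h_nonneg)
      (M.β_pow_nonneg (s - 1))
    rw [hS s hs1]
    linarith
  have hlast : ∀ s, expired x' q' d s = max (stock (x' s) (q' s) (M.K - 1) - d s) 0 := by
    intro s
    rw [expired, tail_last]
  simp only [hlast] at hw
  have hl := add_le_add hrest hw
  rw [← Finset.sum_add_distrib, ← Finset.sum_add_distrib] at hl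
  rw [← Finset.sum_add_distrib]
  refine le_trans (le_of_eq ?_) (hl.trans (le_of_eq ?_))
  · exact Finset.sum_congr rfl fun s _ => by ring
  · exact Finset.sum_congr rfl fun s _ => by ring

/-- The two cost accountings differ by the cost of ordering exactly the demand. -/
theorem costHat_path_eq (M : Model μ 𝒰) {x : ℕ → Inv M.K} {q d : ℕ → ℝ}
    (H : IsTrajectory x q d) :
    ∑ t ∈ Finset.Icc 1 M.T, M.β ^ (t - 1) *
        (M.cHat * q t + M.pHat * max (d t - total (x t) (q t)) 0
          + M.hHat * max (total (x t) (q t) - d t) 0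
          + M.wHat * max (stock (x t) (q t) (M.K - 1) - d t) 0)
      - M.β ^ M.T * M.cHat * ∑ i, x (M.T + 1) i
    = M.pathCost x q d + M.cHat * ∑ t ∈ Finset.Icc 1 M.T, M.β ^ (t - 1) * d t := by
  rw [pathCost]
  -- The horizon is freed for induction: stock balance turns the change of the salvage term into the
  -- shifts from `pHat`, `hHat`, `wHat` to `p`, `h`, `w`.
  generalize M.T = T
  induction T with
  | zero => simp [H.start]
  | succ T ih =>
    have h1 := H.tail_succ (t := T + 1) (by omega) (Nat.zero_le _)
    rw [zero_add, tail_one, tail_zero, expired, tail_last] at h1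
    have h2 : max (total (x (T + 1)) (q (T + 1)) - d (T + 1)) 0
        - max (d (T + 1) - total (x (T + 1)) (q (T + 1))) 0
        = total (x (T + 1)) (q (T + 1)) - d (T + 1) := by
      rcases le_total (d (T + 1)) (total (x (T + 1)) (q (T + 1))) with h | h
      · rw [max_eq_left (by linarith), max_eq_right (by linarith)]; ring
      · rw [max_eq_right (by linarith), max_eq_left (by linarith)]; ring
    have h3 : total (x (T + 1)) (q (T + 1)) = ∑ i, x (T + 1) i + q (T + 1) := rfl
    rw [Finset.sum_Icc_succ_top (by omega), Finset.sum_Icc_succ_top (by omega),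
      Finset.sum_Icc_succ_top (by omega), h1]
    have ih' := sub_eq_iff_eq_add.1 ih
    rw [ih', Nat.add_sub_cancel, pow_succ, p, h, w]
    generalize max (d (T + 1) - total (x (T + 1)) (q (T + 1))) 0 = a at *
    generalize max (total (x (T + 1)) (q (T + 1)) - d (T + 1)) 0 = b at *
    generalize max (stock (x (T + 1)) (q (T + 1)) (M.K - 1) - d (T + 1)) 0 = e at *
    linear_combination -(M.β ^ T * M.cHat) * (h2 + h3)

theorem isTrajectory (M : Model μ 𝒰) (π : Policy M.K 𝒰) {ω : Ω} (hω : ∀ t, 0 ≤ M.D t ω) :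
    IsTrajectory (fun t => M.inv π t ω) (fun t => M.ordered π t ω) (fun t => M.D t ω) where
  start := rfl
  step t ht := by
    obtain ⟨t, rfl⟩ : ∃ s, t = s + 1 := ⟨t - 1, by omega⟩
    rfl
  order_nonneg t := π.order_nonneg _ _ _
  demand_nonneg := hω

theorem ae_demand_nonneg (M : Model μ 𝒰) : ∀ᵐ ω ∂μ, ∀ t, 0 ≤ M.D t ω :=
  ae_all_iff.2 M.D_nonneg

/-- Inventory carried over never exceeds the preceding level `S`, so the truncation in the order is
never active. -/
theorem level_baseStock (M : Model μ 𝒰) {S : ℝ} (hS : 0 ≤ S) {ω : Ω} (hω : ∀ t, 0 ≤ M.D t ω)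
    {t : ℕ} (ht : 1 ≤ t) : M.level (baseStock M.K 𝒰 S) t ω = S := by
  have H := M.isTrajectory (baseStock M.K 𝒰 S) hω
  have key : ∀ t, ∑ i, M.inv (baseStock M.K 𝒰 S) t ω i ≤ S →
      M.level (baseStock M.K 𝒰 S) t ω = S := by
    intro t h
    simp only [level, total, ordered, baseStock]
    rw [max_eq_left (by simpa [baseStock] using h)]
    ring
  refine key t ?_
  induction t, ht using Nat.le_induction with
  | base => simpa [inv] using hS
  | succ t ht ih =>
    have h1 := H.tail_succ_le ht (Nat.zero_le _)
    rw [zero_add, tail_one, tail_zero] at h1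
    exact h1.trans_eq (key t ih)

theorem costHat_eq (M : Model μ 𝒰) (π : Policy M.K 𝒰) {ω : Ω} (hω : ∀ t, 0 ≤ M.D t ω) :
    M.costHat π ω
      = M.cost π ω + M.cHat * ∑ t ∈ Finset.Icc 1 M.T, M.β ^ (t - 1) * M.D t ω :=
  M.costHat_path_eq (M.isTrajectory π hω)

end Costs

end Model

end Perishable

namespace Perishable

/-! ### Measurability, integrability, and states as functions of the information. -/

section Measurability

variable {α : Type*} [MeasurableSpace α] {K : ℕ} {x : α → Inv K} {q : α → ℝ} {d : α → ℕ → ℝ}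

theorem measurable_stock (hx : Measurable x) (hq : Measurable q) (k : ℕ) :
    Measurable fun a => stock (x a) (q a) k := by
  unfold stock
  split_ifs
  · exact hq
  · exact (measurable_pi_apply _).comp hx
  · exact measurable_const

theorem measurable_total (hx : Measurable x) (hq : Measurable q) :
    Measurable fun a => total (x a) (q a) := by
  unfold total
  fun_prop

theorem measurable_nextInv (hx : Measurable x) (hq : Measurable q) {e : α → ℝ}
    (he : Measurable e) : Measurable fun a => nextInv (x a) (q a) (e a) := by
  refine measurable_pi_lambda _ fun i => ?_
  have h := fun m => measurable_stock hx hq m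
  unfold nextInv
  exact ((h _).sub ((he.sub (Finset.measurable_sum _ fun m _ => h m)).max
    measurable_const)).max measurable_const

theorem measurable_unmet (hx : Measurable x) (hd : Measurable d) (t k : ℕ) :
    Measurable fun a => unmet (x a) (d a) t k := by
  induction k with
  | zero => exact measurable_const
  | succ k ih =>
    exact ((ih.add ((measurable_pi_apply _).comp hd)).sub
      (measurable_stock hx measurable_const _)).max measurable_const

theorem measurable_leftOver (hx : Measurable x) (hq : Measurable q) (hd : Measurable d)
    (t k : ℕ) : Measurable fun a => leftOver (x a) (q a) (d a) t k :=
  (hq.sub ((((measurable_unmet hx hd t k).add ((measurable_pi_apply _).comp hd)).sub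
    (Finset.measurable_sum _ fun m _ => measurable_stock hx measurable_const m)).max
      measurable_const)).max measurable_const

theorem measurable_outdated (hx : Measurable x) (hq : Measurable q) (hd : Measurable d)
    (t : ℕ) : Measurable fun a => outdated (x a) (q a) (d a) t :=
  ((hq.sub (measurable_unmet hx hd t _)).sub ((measurable_pi_apply _).comp hd)).max
    measurable_const

theorem leftOver_nonneg (x : Inv K) (q : ℝ) (d : ℕ → ℝ) (t k : ℕ) : 0 ≤ leftOver x q d t k :=
  le_max_right _ _

theorem outdated_nonneg (x : Inv K) (q : ℝ) (d : ℕ → ℝ) (t : ℕ) : 0 ≤ outdated x q d t :=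
  le_max_right _ _

theorem leftOver_le (x : Inv K) {q : ℝ} (hq : 0 ≤ q) (d : ℕ → ℝ) (t k : ℕ) :
    leftOver x q d t k ≤ q :=
  max_le (sub_le_self _ (le_max_right _ _)) hq

/-- The absolute value is there because the path `d` is arbitrary and may have negative entries. -/
theorem outdated_le (x : Inv K) {q : ℝ} (hq : 0 ≤ q) (d : ℕ → ℝ) (t : ℕ) :
    outdated x q d t ≤ q + |d (t + K - 1)| :=
  max_le (by linarith [unmet_nonneg x d t (K - 1), neg_abs_le (d (t + K - 1))])
    (add_nonneg hq (abs_nonneg _))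

end Measurability

/-- If two nonnegative functions have the same conditional integrals and one of them is integrable,
so is the other, and their integrals over every event of the first variable agree. -/
theorem integrable_compProd_of_integral_eq {α β : Type*} [MeasurableSpace α] [MeasurableSpace β]
    {ν : Measure α} [SFinite ν] {κ : Kernel α β} [IsSFiniteKernel κ] {g g' : α × β → ℝ}
    (hg : Integrable g (ν ⊗ₘ κ)) (hg' : Measurable g') (hg0 : ∀ z, 0 ≤ g z) (hg0' : ∀ z, 0 ≤ g' z)
    (hint : ∀ᵐ a ∂ν, Integrable (fun b => g' (a, b)) (κ a))
    (heq : ∀ᵐ a ∂ν, ∫ b, g (a, b) ∂κ a = ∫ b, g' (a, b) ∂κ a) :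
    Integrable g' (ν ⊗ₘ κ) ∧ ∀ s : Set α, MeasurableSet s →
      ∫ z in s ×ˢ Set.univ, g z ∂(ν ⊗ₘ κ) = ∫ z in s ×ˢ Set.univ, g' z ∂(ν ⊗ₘ κ) := by
  have hi : Integrable g' (ν ⊗ₘ κ) := by
    rw [Measure.integrable_compProd_iff hg'.aestronglyMeasurable]
    refine ⟨hint, ?_⟩
    -- By nonnegativity, equal conditional integrals are equal conditional `L¹` norms.
    refine ((Measure.integrable_compProd_iff hg.aestronglyMeasurable).1 hg).2.congr ?_
    filter_upwards [heq] with a ha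
    simp only [Real.norm_of_nonneg (hg0 _), Real.norm_of_nonneg (hg0' _)]
    exact ha
  refine ⟨hi, fun s hs => ?_⟩
  rw [Measure.setIntegral_compProd hs MeasurableSet.univ hg.integrableOn,
    Measure.setIntegral_compProd hs MeasurableSet.univ hi.integrableOn]
  simp only [Measure.restrict_univ]
  exact integral_congr_ae (ae_restrict_of_ae heq)

namespace Model

variable {Ω : Type*} [MeasurableSpace Ω] {μ : Measure Ω} {𝒰 : Type*} [MeasurableSpace 𝒰]

theorem measurable_info (M : Model μ 𝒰) (t : ℕ) : Measurable (M.info t) :=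
  (measurable_pi_lambda _ fun _ => M.measurable_D _).prodMk
    (measurable_pi_lambda _ fun _ => M.measurable_U _)

theorem measurable_path (M : Model μ 𝒰) : Measurable fun ω s => M.D s ω :=
  measurable_pi_lambda _ M.measurable_D

/-- Information of the preceding period. -/
def _root_.Perishable.Info.prev {t : ℕ} (f : Info 𝒰 (t + 1)) : Info 𝒰 t :=
  (fun s => f.1 ⟨s, s.2.1, s.2.2.trans (Nat.lt_succ_self t)⟩,
    fun s => f.2 ⟨s, s.2.1, s.2.2.trans (Nat.le_succ t)⟩)

theorem _root_.Perishable.Info.measurable_prev {t : ℕ} :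
    Measurable (Info.prev : Info 𝒰 (t + 1) → Info 𝒰 t) :=
  (measurable_pi_lambda _ fun _ => (measurable_pi_apply _).comp measurable_fst).prodMk
    (measurable_pi_lambda _ fun _ => (measurable_pi_apply _).comp measurable_snd)

/-- The inventory vector as a function of the information. -/
def invOfInfo {K : ℕ} (π : Policy K 𝒰) : (t : ℕ) → Info 𝒰 t → Inv K
  | 0, _ => 0
  | 1, _ => 0
  | t + 2, f => nextInv (invOfInfo π (t + 1) f.prev)
      (π.order (t + 1) (invOfInfo π (t + 1) f.prev) f.prev)
      (f.1 ⟨t + 1, Nat.le_add_left 1 t, Nat.lt_succ_self _⟩)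

theorem invOfInfo_nonneg {K : ℕ} (π : Policy K 𝒰) :
    ∀ (t : ℕ) (f : Info 𝒰 t) (i : Fin (K - 1)), 0 ≤ invOfInfo π t f i
  | 0, _, _ => le_rfl
  | 1, _, _ => le_rfl
  | _ + 2, _, _ => nextInv_nonneg _ _ _ _

theorem measurable_invOfInfo {K : ℕ} (π : Policy K 𝒰) (t : ℕ) :
    Measurable (invOfInfo π t) := by
  match t with
  | 0 => exact measurable_const
  | 1 => exact measurable_const
  | t + 2 =>
    have h := (measurable_invOfInfo π (t + 1)).comp (Info.measurable_prev (𝒰 := 𝒰))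
    exact measurable_nextInv h
      ((π.measurable_order (t + 1)).comp (h.prodMk Info.measurable_prev))
      ((measurable_pi_apply _).comp measurable_fst)

theorem invOfInfo_info (M : Model μ 𝒰) (π : Policy M.K 𝒰) (ω : Ω) (t : ℕ) :
    invOfInfo π t (M.info t ω) = M.inv π t ω := by
  match t with
  | 0 => rfl
  | 1 => rfl
  | t + 2 =>
    have h := M.invOfInfo_info π ω (t + 1)
    simp only [invOfInfo, inv]
    rw [← h]
    rfl

/-- The ordering quantity as a function of the information. -/
def orderOfInfo {K : ℕ} (π : Policy K 𝒰) (t : ℕ) (f : Info 𝒰 t) : ℝ :=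
  π.order t (invOfInfo π t f) f

theorem measurable_orderOfInfo {K : ℕ} (π : Policy K 𝒰) (t : ℕ) :
    Measurable (orderOfInfo π t) :=
  (π.measurable_order t).comp ((measurable_invOfInfo π t).prodMk measurable_id)

theorem orderOfInfo_info (M : Model μ 𝒰) (π : Policy M.K 𝒰) (ω : Ω) (t : ℕ) :
    orderOfInfo π t (M.info t ω) = M.ordered π t ω := by
  rw [orderOfInfo, invOfInfo_info, ordered]

theorem measurable_inv (M : Model μ 𝒰) (π : Policy M.K 𝒰) (t : ℕ) : Measurable (M.inv π t) := by
  have h := (measurable_invOfInfo π t).comp (M.measurable_info t)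
  exact (funext fun ω => M.invOfInfo_info π ω t) ▸ h

theorem measurable_ordered (M : Model μ 𝒰) (π : Policy M.K 𝒰) (t : ℕ) :
    Measurable (M.ordered π t) := by
  have h := (measurable_orderOfInfo π t).comp (M.measurable_info t)
  exact (funext fun ω => M.orderOfInfo_info π ω t) ▸ h

theorem measurable_level (M : Model μ 𝒰) (π : Policy M.K 𝒰) (t : ℕ) :
    Measurable (M.level π t) :=
  measurable_total (M.measurable_inv π t) (M.measurable_ordered π t)

theorem measurable_cost (M : Model μ 𝒰) (π : Policy M.K 𝒰) : Measurable (M.cost π) := by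
  have h1 := M.measurable_D
  have h2 := M.measurable_level π
  have h3 : ∀ t, Measurable (M.oldest π t) := fun t =>
    measurable_stock (M.measurable_inv π t) (M.measurable_ordered π t) _
  unfold cost
  fun_prop

theorem measurable_shortageCost (M : Model μ 𝒰) {α : Type*} [MeasurableSpace α]
    {x : α → Inv M.K} {q : α → ℝ} {d : α → ℕ → ℝ} (hx : Measurable x) (hq : Measurable q)
    (hd : Measurable d) (t : ℕ) : Measurable fun a => M.shortageCost t (x a) (q a) (d a) :=
  ((((measurable_pi_apply t).comp hd).sub (measurable_total hx hq)).max
    measurable_const).const_mul _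

theorem measurable_overageCost (M : Model μ 𝒰) {α : Type*} [MeasurableSpace α]
    {x : α → Inv M.K} {q : α → ℝ} {d : α → ℕ → ℝ} (hx : Measurable x) (hq : Measurable q)
    (hd : Measurable d) (t : ℕ) : Measurable fun a => M.overageCost t (x a) (q a) (d a) := by
  refine (Finset.measurable_sum _ fun k _ =>
    (measurable_leftOver hx hq hd t k).const_mul _).add ?_
  split_ifs
  exacts [(measurable_outdated hx hq hd t).const_mul _, measurable_const]

theorem integrable_leftOver {K : ℕ} (ρ : Measure (ℕ → ℝ)) [IsFiniteMeasure ρ] (x : Inv K) {q : ℝ}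
    (hq : 0 ≤ q) (t k : ℕ) : Integrable (fun d => leftOver x q d t k) ρ := by
  refine (integrable_const q).mono'
    (measurable_leftOver measurable_const measurable_const measurable_id t k).aestronglyMeasurable
    (Filter.Eventually.of_forall fun d => ?_)
  rw [Real.norm_of_nonneg (leftOver_nonneg _ _ _ _ _)]
  exact leftOver_le x hq d t k

theorem integrable_outdated {K : ℕ} (ρ : Measure (ℕ → ℝ)) [IsFiniteMeasure ρ] (x : Inv K) {q : ℝ}
    (hq : 0 ≤ q) (t : ℕ) (hρ : Integrable (fun d : ℕ → ℝ => d (t + K - 1)) ρ) :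
    Integrable (fun d => outdated x q d t) ρ := by
  refine ((integrable_const q).add hρ.abs).mono'
    (measurable_outdated measurable_const measurable_const measurable_id t).aestronglyMeasurable
    (Filter.Eventually.of_forall fun d => ?_)
  rw [Real.norm_of_nonneg (outdated_nonneg _ _ _ _)]
  exact outdated_le x hq d t

theorem integrable_overageCost (M : Model μ 𝒰) (ρ : Measure (ℕ → ℝ)) [IsFiniteMeasure ρ]
    (x : Inv M.K) {q : ℝ} (hq : 0 ≤ q) (t : ℕ)
    (hρ : Integrable (fun d : ℕ → ℝ => d (t + M.K - 1)) ρ) :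
    Integrable (M.overageCost t x q) ρ := by
  refine (integrable_finsetSum _ fun k _ =>
    (integrable_leftOver ρ x hq t k).const_mul _).add ?_
  split_ifs
  exacts [(integrable_outdated ρ x hq t hρ).const_mul _, integrable_zero _ _ _]

theorem integrable_shortageCost (M : Model μ 𝒰) (π : Policy M.K 𝒰) {t : ℕ} (ht : 1 ≤ t) :
    Integrable (fun ω => M.shortageCost t (M.inv π t ω) (M.ordered π t ω) fun s => M.D s ω) μ := by
  refine ((M.integrable_D t).const_mul (M.β ^ (t - 1) * M.p)).mono'
    (M.measurable_shortageCost (M.measurable_inv π t) (M.measurable_ordered π t)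
      M.measurable_path t).aestronglyMeasurable ?_
  filter_upwards [M.ae_demand_nonneg] with ω hω
  rw [Real.norm_of_nonneg (M.shortageCost_nonneg _ _ _ _)]
  refine mul_le_mul_of_nonneg_left (max_le ?_ (hω t))
    (mul_nonneg (M.β_pow_nonneg _) M.p_nonneg)
  have := (M.isTrajectory π hω).tail_nonneg ht 0
  rw [tail_zero] at this
  linarith

/-- The expected costs differ by the expected discounted cost of ordering exactly the demand. -/
theorem costHat_integral (M : Model μ 𝒰) {π : Policy M.K 𝒰} (hπ : Integrable (M.cost π) μ) :
    Integrable (M.costHat π) μ ∧ ∫ ω, M.costHat π ω ∂μ = ∫ ω, M.cost π ω ∂μ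
      + ∫ ω, M.cHat * ∑ t ∈ Finset.Icc 1 M.T, M.β ^ (t - 1) * M.D t ω ∂μ := by
  have hD : Integrable (fun ω => M.cHat * ∑ t ∈ Finset.Icc 1 M.T, M.β ^ (t - 1) * M.D t ω) μ :=
    (integrable_finsetSum _ fun t _ => (M.integrable_D t).const_mul _).const_mul _
  have hae : M.costHat π =ᵐ[μ]
      fun ω => M.cost π ω + M.cHat * ∑ t ∈ Finset.Icc 1 M.T, M.β ^ (t - 1) * M.D t ω := by
    filter_upwards [M.ae_demand_nonneg] with ω hω
    exact M.costHat_eq π hω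
  exact ⟨(hπ.add hD).congr hae.symm, by rw [integral_congr_ae hae, integral_add hπ hD]⟩

theorem integral_demand_cost_nonneg (M : Model μ 𝒰) :
    0 ≤ ∫ ω, M.cHat * ∑ t ∈ Finset.Icc 1 M.T, M.β ^ (t - 1) * M.D t ω ∂μ := by
  refine integral_nonneg_of_ae ?_
  filter_upwards [M.ae_demand_nonneg] with ω hω
  exact mul_nonneg M.cHat_nonneg
    (Finset.sum_nonneg fun t _ => mul_nonneg (M.β_pow_nonneg _) (hω t))

/-! ### Conditional expectations, balancing and the expected-cost bound. -/

variable [IsFiniteMeasure μ]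

instance (M : Model μ 𝒰) (t : ℕ) : IsMarkovKernel (M.demandLaw t) := by
  unfold demandLaw; infer_instance

theorem compProd_demandLaw (M : Model μ 𝒰) (t : ℕ) :
    (μ.map (M.info t)) ⊗ₘ (M.demandLaw t) = μ.map fun ω => (M.info t ω, fun s => M.D s ω) :=
  compProd_map_condDistrib M.measurable_path.aemeasurable

theorem integrable_demandLaw (M : Model μ 𝒰) (t s : ℕ) :
    ∀ᵐ f ∂μ.map (M.info t), Integrable (fun d : ℕ → ℝ => d s) (M.demandLaw t f) := by
  have hm : Measurable fun z : Info 𝒰 t × (ℕ → ℝ) => z.2 s :=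
    (measurable_pi_apply s).comp measurable_snd
  refine ((Measure.integrable_compProd_iff (f := fun z : Info 𝒰 t × (ℕ → ℝ) => z.2 s)
    hm.aestronglyMeasurable).1 ?_).1
  rw [compProd_demandLaw, integrable_map_measure hm.aestronglyMeasurable
    ((M.measurable_info t).prodMk M.measurable_path).aemeasurable]
  exact M.integrable_D s

theorem integral_shortageCost (M : Model μ 𝒰) (t : ℕ) (x : Inv M.K) (f : Info 𝒰 t) (q : ℝ) :
    ∫ d, M.shortageCost t x q d ∂M.demandLaw t f = M.marginalShortage t x f q :=
  integral_const_mul _ _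

theorem integral_overageCost (M : Model μ 𝒰) (t : ℕ) (x : Inv M.K) (f : Info 𝒰 t) {q : ℝ}
    (hq : 0 ≤ q) (hf : Integrable (fun d : ℕ → ℝ => d (t + M.K - 1)) (M.demandLaw t f)) :
    ∫ d, M.overageCost t x q d ∂M.demandLaw t f
      = M.marginalHolding t x f q + M.marginalOutdating t x f q := by
  have h1 := fun k => (integrable_leftOver (M.demandLaw t f) x hq t k).const_mul
    (M.β ^ (t + k - 1) * M.h)
  have h2 := integrable_outdated (M.demandLaw t f) x hq t hf
  unfold overageCost marginalHolding marginalOutdating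
  rw [integral_add (integrable_finsetSum _ fun k _ => h1 k), integral_finsetSum _ fun k _ => h1 k]
  · simp only [integral_const_mul]
    split_ifs
    · rw [integral_const_mul]
    · rw [integral_zero]
  · split_ifs
    exacts [h2.const_mul _, integrable_zero _ _ _]

/-- Under a dual-balancing policy, the shortage penalty of a period and the overage costs of its
order have the same expectation on every event known at the beginning of that period. -/
theorem IsDualBalancing.balance {M : Model μ 𝒰} {B : Policy M.K 𝒰} (hB : M.IsDualBalancing B)
    {t : ℕ} (ht : t ∈ Finset.Icc 1 M.T) :
    Integrable (fun ω => M.overageCost t (M.inv B t ω) (M.ordered B t ω) fun s => M.D s ω) μ ∧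
    ∀ s : Set (Info 𝒰 t), MeasurableSet s →
      ∫ ω in M.info t ⁻¹' s,
          M.shortageCost t (M.inv B t ω) (M.ordered B t ω) (fun s => M.D s ω) ∂μ
        = ∫ ω in M.info t ⁻¹' s,
          M.overageCost t (M.inv B t ω) (M.ordered B t ω) (fun s => M.D s ω) ∂μ := by
  have hx : Measurable fun z : Info 𝒰 t × (ℕ → ℝ) => invOfInfo B t z.1 :=
    (measurable_invOfInfo B t).comp measurable_fst
  have hq : Measurable fun z : Info 𝒰 t × (ℕ → ℝ) => orderOfInfo B t z.1 :=
    (measurable_orderOfInfo B t).comp measurable_fst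
  have hφ : Measurable fun ω => (M.info t ω, fun s => M.D s ω) :=
    (M.measurable_info t).prodMk M.measurable_path
  have hm1 := M.measurable_shortageCost hx hq measurable_snd t
  have hm2 := M.measurable_overageCost hx hq measurable_snd t
  have hsh := M.integrable_shortageCost B (Finset.mem_Icc.1 ht).1
  simp only [← orderOfInfo_info, ← invOfInfo_info] at hsh ⊢
  have hg : Integrable (fun z : Info 𝒰 t × (ℕ → ℝ) =>
      M.shortageCost t (invOfInfo B t z.1) (orderOfInfo B t z.1) z.2)
      ((μ.map (M.info t)) ⊗ₘ (M.demandLaw t)) := by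
    rw [compProd_demandLaw, integrable_map_measure hm1.aestronglyMeasurable hφ.aemeasurable]
    exact hsh
  obtain ⟨h1, h2⟩ := integrable_compProd_of_integral_eq hg hm2
    (fun _ => M.shortageCost_nonneg _ _ _ _) (fun _ => M.overageCost_nonneg _ _ _ _)
    -- Given the information the order is a constant, so the overage cost is conditionally
    -- integrable. This excludes the default value `0` of a divergent integral in the balance
    -- equation.
    (by
      filter_upwards [M.integrable_demandLaw t (t + M.K - 1)] with f hf
      exact M.integrable_overageCost _ _ (B.order_nonneg _ _ _) t hf)
    (by
      filter_upwards [M.integrable_demandLaw t (t + M.K - 1), hB t ht] with f hf hbal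
      exact (M.integral_shortageCost _ _ _ _).trans ((hbal _ (invOfInfo_nonneg B t f)).trans
        (M.integral_overageCost _ _ _ (B.order_nonneg _ _ _) hf).symm))
  rw [compProd_demandLaw] at h1 h2
  refine ⟨(integrable_map_measure hm2.aestronglyMeasurable hφ.aemeasurable).1 h1,
    fun s hs => ?_⟩
  have h3 := h2 s hs
  rw [setIntegral_map (hs.prod MeasurableSet.univ) hm1.aestronglyMeasurable hφ.aemeasurable,
    setIntegral_map (hs.prod MeasurableSet.univ) hm2.aestronglyMeasurable hφ.aemeasurable] at h3
  have hpre : (fun ω => (M.info t ω, fun s => M.D s ω)) ⁻¹' (s ×ˢ (Set.univ : Set (ℕ → ℝ)))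
      = M.info t ⁻¹' s := by
    ext ω
    simp
  rwa [hpre] at h3

theorem integrable_cost_baseStock (M : Model μ 𝒰) {S : ℝ} (hS : 0 ≤ S) :
    Integrable (M.cost (baseStock M.K 𝒰 S)) μ := by
  set π := baseStock M.K 𝒰 S with hπ
  have hbound : Integrable (fun ω => ∑ t ∈ Finset.Icc 1 M.T,
      M.β ^ (t - 1) * (M.p * M.D t ω + M.h * S + M.w * S)) μ := by
    have hD := M.integrable_D
    fun_prop
  refine hbound.mono' (M.measurable_cost π).aestronglyMeasurable ?_
  filter_upwards [M.ae_demand_nonneg] with ω hω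
  have hmax : ∀ a : ℝ, 0 ≤ max a 0 := fun a => le_max_right _ _
  rw [cost, Real.norm_of_nonneg (Finset.sum_nonneg fun t _ => mul_nonneg (M.β_pow_nonneg _)
    (add_nonneg (add_nonneg (mul_nonneg M.p_nonneg (hmax _)) (mul_nonneg M.h_nonneg (hmax _)))
      (mul_nonneg M.w_nonneg (hmax _))))]
  refine Finset.sum_le_sum fun t ht => mul_le_mul_of_nonneg_left ?_ (M.β_pow_nonneg _)
  have ht1 := (Finset.mem_Icc.1 ht).1
  have hl := M.level_baseStock hS hω ht1
  have ho : M.oldest π t ω ≤ S := by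
    have H := M.isTrajectory π hω
    rw [← hl, level, ← tail_zero, oldest, ← tail_last]
    exact antitone_nat_of_succ_le
      (tail_succ_le (H.nonneg t ht1) (H.order_nonneg t)) (Nat.zero_le _)
  rw [← hπ] at hl
  rw [hl]
  have hd := hω t
  exact add_le_add (add_le_add
    (mul_le_mul_of_nonneg_left (max_le (by linarith) hd) M.p_nonneg)
    (mul_le_mul_of_nonneg_left (max_le (by linarith) hS) M.h_nonneg))
    (mul_le_mul_of_nonneg_left (max_le (by linarith) hS) M.w_nonneg)

/-- The expected cost of a dual-balancing policy is twice its expected shortage penalty. -/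
theorem IsDualBalancing.integral_cost {M : Model μ 𝒰} {B : Policy M.K 𝒰}
    (hB : M.IsDualBalancing B) :
    Integrable (M.cost B) μ ∧ ∫ ω, M.cost B ω ∂μ = 2 * ∑ t ∈ Finset.Icc 1 M.T,
      ∫ ω, M.shortageCost t (M.inv B t ω) (M.ordered B t ω) (fun s => M.D s ω) ∂μ := by
  have hae : (fun ω => ∑ t ∈ Finset.Icc 1 M.T,
          M.shortageCost t (M.inv B t ω) (M.ordered B t ω) (fun s => M.D s ω)
        + ∑ t ∈ Finset.Icc 1 M.T,
          M.overageCost t (M.inv B t ω) (M.ordered B t ω) (fun s => M.D s ω)) =ᵐ[μ] M.cost B := by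
    filter_upwards [M.ae_demand_nonneg] with ω hω
    exact (M.pathCost_eq (M.isTrajectory B hω)).symm
  have hs : ∀ t ∈ Finset.Icc 1 M.T, Integrable (fun ω =>
      M.shortageCost t (M.inv B t ω) (M.ordered B t ω) fun s => M.D s ω) μ :=
    fun t ht => M.integrable_shortageCost B (Finset.mem_Icc.1 ht).1
  have ho := fun t (ht : t ∈ Finset.Icc 1 M.T) => (hB.balance ht).1
  refine ⟨((integrable_finsetSum _ hs).add (integrable_finsetSum _ ho)).congr hae, ?_⟩
  rw [← integral_congr_ae hae, integral_add (integrable_finsetSum _ hs)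
    (integrable_finsetSum _ ho), integral_finsetSum _ hs, integral_finsetSum _ ho, two_mul]
  congr 1
  refine Finset.sum_congr rfl fun t ht => ?_
  simpa using ((hB.balance ht).2 Set.univ MeasurableSet.univ).symm

theorem IsDualBalancing.integral_cost_le {M : Model μ 𝒰} {B : Policy M.K 𝒰}
    (hB : M.IsDualBalancing B) {S : ℝ} (hS : 0 ≤ S) :
    ∫ ω, M.cost B ω ∂μ ≤ 2 * ∫ ω, M.cost (baseStock M.K 𝒰 S) ω ∂μ := by
  rw [hB.integral_cost.2]
  refine mul_le_mul_of_nonneg_left ?_ zero_le_two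
  let sh : ℕ → Ω → ℝ := fun t ω =>
    M.shortageCost t (M.inv B t ω) (M.ordered B t ω) fun s => M.D s ω
  let ov : ℕ → Ω → ℝ := fun t ω =>
    M.overageCost t (M.inv B t ω) (M.ordered B t ω) fun s => M.D s ω
  let A : ℕ → Set Ω := fun t => {ω | M.level B t ω < S}
  have hA : ∀ t, MeasurableSet (A t) := fun t =>
    measurableSet_lt (M.measurable_level B t) measurable_const
  have hs : ∀ t ∈ Finset.Icc 1 M.T, Integrable (sh t) μ :=
    fun t ht => M.integrable_shortageCost B (Finset.mem_Icc.1 ht).1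
  have ho : ∀ t ∈ Finset.Icc 1 M.T, Integrable (ov t) μ := fun t ht => (hB.balance ht).1
  have hbal : ∀ t ∈ Finset.Icc 1 M.T, ∫ ω in A t, sh t ω ∂μ = ∫ ω in A t, ov t ω ∂μ := by
    intro t ht
    -- Inventory and order are functions of the information, so whether the level is below `S` is
    -- known at the beginning of period `t`.
    have h := (hB.balance ht).2 {f | total (invOfInfo B t f) (orderOfInfo B t f) < S}
      (measurableSet_lt (measurable_total (measurable_invOfInfo B t) (measurable_orderOfInfo B t))
        measurable_const)
    simp only [Set.preimage_ofPred_eq, invOfInfo_info, orderOfInfo_info] at h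
    exact h
  have hterm : ∀ t ∈ Finset.Icc 1 M.T,
      Integrable (fun ω => (A t).indicator (ov t) ω + (sh t ω - (A t).indicator (sh t) ω)) μ :=
    fun t ht => ((ho t ht).indicator (hA t)).add ((hs t ht).sub ((hs t ht).indicator (hA t)))
  calc ∑ t ∈ Finset.Icc 1 M.T, ∫ ω, sh t ω ∂μ
      = ∫ ω, ∑ t ∈ Finset.Icc 1 M.T,
          ((A t).indicator (ov t) ω + (sh t ω - (A t).indicator (sh t) ω)) ∂μ := by
        rw [integral_finsetSum _ hterm]
        refine Finset.sum_congr rfl fun t ht => ?_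
        rw [integral_add ((ho t ht).indicator (hA t))
          (g := fun ω => sh t ω - (A t).indicator (sh t) ω)
          ((hs t ht).sub ((hs t ht).indicator (hA t))),
          integral_sub (hs t ht) ((hs t ht).indicator (hA t)), integral_indicator (hA t),
          integral_indicator (hA t), hbal t ht]
        ring
    _ ≤ _ := by
        refine integral_mono_ae (integrable_finsetSum _ hterm) (M.integrable_cost_baseStock hS) ?_
        filter_upwards [M.ae_demand_nonneg] with ω hω
        have h := M.le_pathCost (M.isTrajectory B hω) (M.isTrajectory (baseStock M.K 𝒰 S) hω)
          fun t ht => M.level_baseStock hS hω ht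
        refine le_of_eq_of_le (Finset.sum_congr rfl fun t _ => ?_) h
        simp only [Set.indicator_apply]
        rfl

end Model

end Perishable

/-- A marginal-cost dual-balancing policy costs in expectation at most twice as much as the
base-stock policy of any level `S`, in particular of an optimal level; this holds for the total
cost of the transformed problem as well as for the total cost in the original parameters. -/
theorem theorem2 {Ω : Type*} [MeasurableSpace Ω] (μ : MeasureTheory.Measure Ω)
    [MeasureTheory.IsProbabilityMeasure μ] {𝒰 : Type*} [MeasurableSpace 𝒰]
    (M : Perishable.Model μ 𝒰) (B : Perishable.Policy M.K 𝒰) (hB : M.IsDualBalancing B) :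
    MeasureTheory.Integrable (M.cost B) μ ∧ MeasureTheory.Integrable (M.costHat B) μ ∧
    ∀ S : ℝ, 0 ≤ S →
      MeasureTheory.Integrable (M.cost (Perishable.baseStock M.K 𝒰 S)) μ ∧
      MeasureTheory.Integrable (M.costHat (Perishable.baseStock M.K 𝒰 S)) μ ∧
      ∫ ω, M.cost B ω ∂μ ≤ 2 * ∫ ω, M.cost (Perishable.baseStock M.K 𝒰 S) ω ∂μ ∧
      ∫ ω, M.costHat B ω ∂μ ≤ 2 * ∫ ω, M.costHat (Perishable.baseStock M.K 𝒰 S) ω ∂μ := by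
  have hcost := hB.integral_cost.1
  have hhat := M.costHat_integral hcost
  refine ⟨hcost, hhat.1, fun S hS => ?_⟩
  have hbase := M.integrable_cost_baseStock hS
  have hbaseHat := M.costHat_integral hbase
  have hle := hB.integral_cost_le hS
  refine ⟨hbase, hbaseHat.1, hle, ?_⟩
  rw [hhat.2, hbaseHat.2]
  -- The common demand cost occurs once on the left and twice on the right, hence its sign matters.
  linarith [M.integral_demand_cost_nonneg]
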